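/- Let $n\in\mathbb N$ and let $T=(T_{i,j,k}\mid 1\le i<j<k\le n)$ be indeterminates. For $t=(t_{i,j,k})\in\mathbb Z^{\binom n3}$ let $$G(t)=\langle a_1,\dots,a_n \mid a_ja_i=a_ia_j\,a_{j+1}^{t_{i,j,j+1}}\cdots a_n^{t_{i,j,n}}\ (1\le i<j\le n)\rangle ,$$ and let $\mathcal C_n$ be the set of all $t\in\mathbb Z^{\binom n3}$ for which $G(t)$ has Hirsch length exactly $n$ (the Hirsch length of a polycyclic group is the number of infinite factors in a finite subnormal series with cyclic factors). Write $a^x=a_1^{x_1}\cdots a_n^{x_n}$ for $x\in\mathbb Z^n$. Polynomials $F=(F_1,\dots,F_n)$ in $\mathbb Q[T][x_1,\dots,x_n,y_1,\dots,y_n]$ are called multiplication polynomials if for all $t\in\mathcal C_n$ and all $x,y\in\mathbb Z^n$ one has $F(t;x,y)\in\mathbb Z^n$ and $a^xa^y=a^{F(t;x,y)}$ in $G(t)$. Polynomials $K=(K_1,\dots,K_n)$ in $\mathbb Q[T][x_1,\dots,x_n,z]$ are called powering polynomials if for all $t\in\mathcal C_n$, $x\in\mathbb Z^n$, $z\in\mathbb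 Z$ one has $K(t;x,z)\in\mathbb Z^n$ and $(a^x)^z=a^{K(t;x,z)}$ in $G(t)$. Multiplication polynomials and powering polynomials exist. Let $F$ and $K$ be any such polynomials, and let $I_n(T)\subseteq\mathbb Q[T]$ be the ideal generated by all coefficients $C_1(T),\dots,C_r(T)\in\mathbb Q[T]$ of the entries of $$P(T;x,y,w)=F(T;F(T;x,y),w)-F(T;x,F(T;y,w)),$$ considered as polynomials in $x,y,w$. Let $B$ be a Gröbner basis of $I_n(T)$ with respect to any monomial order on $\mathbb Q[T]$. Then each $F_i$ and each $K_i$ has a unique remainder $\hat F_i$, respectively $\hat K_i$, on division by $B$ (the division being carried out in the coefficients in $\mathbb Q[T]$ of the monomials in $x,y$, respectively in $x,z$), and for all $t\in\mathcal C_n$, $x,y\in\mathbb Z^n$, $z\in\mathbb Z$ and $1\le i\le n$ (in particular for $i=n$) $$\hat F_i(t;x,y)=F_i(t;x,y)\qquad\text{and}\qquad \hat K_i(t;x,z)=K_i(t;x,z).$$ Consequently $\hat F_1,\dots,\hat F_n$ are again multiplication polynomials and $\hat K_1,\dots,\hat K_n$ are again powering polynomials. -/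

import Mathlib

namespace NilpotentHall

/-- The triples `(i, j, k)` with `i < j < k`, which index the parameters. -/
abbrev Triple (n : ℕ) : Type :=
  {p : Fin n × Fin n × Fin n // p.1 < p.2.1 ∧ p.2.1 < p.2.2}

/-- The ordered product `a₁ ^ x₁ ⋯ aₙ ^ xₙ` (from left to right). -/
def normalWord {n : ℕ} {G : Type*} [Group G] (a : Fin n → G) (x : Fin n → ℤ) : G :=
  (List.ofFn fun k => a k ^ x k).prod

/-- The exponent of `a_k` in the tail of the relation for `a_j a_i`: it is `t_{i,j,k}` for
`i < j < k`, and the generator `a_k` does not occur in the tail otherwise. -/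
def tailExponent {n : ℕ} (t : Triple n → ℤ) (i j k : Fin n) : ℤ :=
  if h : i < j ∧ j < k then t ⟨(i, j, k), h⟩ else 0

/-- The relators for `a_j a_i = a_i a_j a_{j+1} ^ t_{i,j,j+1} ⋯ a_n ^ t_{i,j,n}`, `i < j`. -/
def relators {n : ℕ} (t : Triple n → ℤ) : Set (FreeGroup (Fin n)) :=
  {r | ∃ i j : Fin n, i < j ∧
    r = (FreeGroup.of j * FreeGroup.of i) *
      (FreeGroup.of i * FreeGroup.of j * normalWord FreeGroup.of (tailExponent t i j))⁻¹}

/-- The group `G(t)`. -/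
abbrev GroupOf {n : ℕ} (t : Triple n → ℤ) : Type := PresentedGroup (relators t)

/-- The generators `a₁, …, aₙ` of `G(t)`. -/
def gen {n : ℕ} (t : Triple n → ℤ) (i : Fin n) : GroupOf t := PresentedGroup.of i

/-- `G` is polycyclic of Hirsch length `h`: it has a finite subnormal series
`G = H₀ ≥ H₁ ≥ ⋯ ≥ H_r = 1` with cyclic factors, exactly `h` of which are infinite. -/
def HasHirschLength (G : Type*) [Group G] (h : ℕ) : Prop :=
  ∃ (r : ℕ) (H : Fin (r + 1) → Subgroup G),
    H 0 = ⊤ ∧ H (Fin.last r) = ⊥ ∧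
    (∀ i : Fin r, H i.succ ≤ H i.castSucc ∧
      ∃ _ : ((H i.succ).subgroupOf (H i.castSucc)).Normal,
        IsCyclic (H i.castSucc ⧸ (H i.succ).subgroupOf (H i.castSucc))) ∧
    Nat.card {i : Fin r //
      Infinite (H i.castSucc ⧸ (H i.succ).subgroupOf (H i.castSucc))} = h

/-- The set `C_n` of all integral parameters `t` for which `G(t)` is consistent, that is, has
Hirsch length precisely `n`. -/
def consistentSet (n : ℕ) : Set (Triple n → ℤ) := {t | HasHirschLength (GroupOf t) n}

/-- The ring `ℚ[T]` of polynomials in the parameters. -/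
abbrev ParamRing (n : ℕ) : Type := MvPolynomial (Triple n) ℚ

/-- The ring `ℚ[T][x, y]`: `Sum.inl i` is the index of `x_i`, `Sum.inr i` that of `y_i`. -/
abbrev MulRing (n : ℕ) : Type := MvPolynomial (Fin n ⊕ Fin n) (ParamRing n)

/-- The ring `ℚ[T][x, z]`: `Sum.inl i` is the index of `x_i`, `Sum.inr ()` that of `z`. -/
abbrev PowRing (n : ℕ) : Type := MvPolynomial (Fin n ⊕ Unit) (ParamRing n)

/-- The value `f(t; v)` of a polynomial with parameters. -/
noncomputable def evalAt {n : ℕ} {σ : Type*} (t : Triple n → ℤ) (v : σ → ℤ)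
    (f : MvPolynomial σ (ParamRing n)) : ℚ :=
  MvPolynomial.eval₂ (MvPolynomial.eval fun s => (t s : ℚ)) (fun s => (v s : ℚ)) f

/-- `F(t; x, y)`. -/
noncomputable def evalMul {n : ℕ} (t : Triple n → ℤ) (x y : Fin n → ℤ) (f : MulRing n) : ℚ :=
  evalAt t (Sum.elim x y) f

/-- `K(t; x, z)`. -/
noncomputable def evalPow {n : ℕ} (t : Triple n → ℤ) (x : Fin n → ℤ) (z : ℤ)
    (f : PowRing n) : ℚ :=
  evalAt t (Sum.elim x fun _ => z) f

/-- `F₁, …, Fₙ` are multiplication polynomials: for every `t ∈ C_n` and all integral `x, y` the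
values `F_i(t; x, y)` are integers and
`(a₁^x₁ ⋯ aₙ^xₙ) (a₁^y₁ ⋯ aₙ^yₙ) = a₁^F₁(t;x,y) ⋯ aₙ^Fₙ(t;x,y)` holds in `G(t)`. -/
def IsMultiplicationPolynomials (n : ℕ) (F : Fin n → MulRing n) : Prop :=
  ∀ t ∈ consistentSet n, ∀ x y : Fin n → ℤ, ∃ e : Fin n → ℤ,
    (∀ i, evalMul t x y (F i) = (e i : ℚ)) ∧
    normalWord (gen t) x * normalWord (gen t) y = normalWord (gen t) e

/-- `K₁, …, Kₙ` are powering polynomials: for every `t ∈ C_n`, all integral `x` and every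
integer `z` the values `K_i(t; x, z)` are integers and
`(a₁^x₁ ⋯ aₙ^xₙ)^z = a₁^K₁(t;x,z) ⋯ aₙ^Kₙ(t;x,z)` holds in `G(t)`. -/
def IsPoweringPolynomials (n : ℕ) (K : Fin n → PowRing n) : Prop :=
  ∀ t ∈ consistentSet n, ∀ (x : Fin n → ℤ) (z : ℤ), ∃ e : Fin n → ℤ,
    (∀ i, evalPow t x z (K i) = (e i : ℚ)) ∧
    normalWord (gen t) x ^ z = normalWord (gen t) e

/-- The ring `ℚ[T][x, y, w]`; the three summands index `x`, `y`, `w` in this order. -/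
abbrev AssocRing (n : ℕ) : Type := MvPolynomial (Fin n ⊕ Fin n ⊕ Fin n) (ParamRing n)

/-- `F(T; u, v)` for polynomial arguments `u, v`. -/
noncomputable def substMul {n : ℕ} (F : Fin n → MulRing n) (u v : Fin n → AssocRing n)
    (i : Fin n) : AssocRing n :=
  MvPolynomial.aeval (Sum.elim u v) (F i)

/-- `P(T; x, y, w) = F(T; F(T; x, y), w) - F(T; x, F(T; y, w))`. -/
noncomputable def associator {n : ℕ} (F : Fin n → MulRing n) (i : Fin n) : AssocRing n :=
  let x : Fin n → AssocRing n := fun k => MvPolynomial.X (Sum.inl k)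
  let y : Fin n → AssocRing n := fun k => MvPolynomial.X (Sum.inr (Sum.inl k))
  let w : Fin n → AssocRing n := fun k => MvPolynomial.X (Sum.inr (Sum.inr k))
  substMul F (substMul F x y) w i - substMul F x (substMul F y w) i

/-- The ideal `I_n(T)` of `ℚ[T]` generated by all coefficients of `P₁, …, Pₙ`, considered as
polynomials in `x, y, w`. -/
noncomputable def consistencyIdeal {n : ℕ} (F : Fin n → MulRing n) : Ideal (ParamRing n) :=
  Ideal.span {c | ∃ (i : Fin n) (d : Fin n ⊕ Fin n ⊕ Fin n →₀ ℕ),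
    c = MvPolynomial.coeff d (associator F i)}

/-- `B` is a Gröbner basis of the ideal `I` with respect to the monomial order `m`: a finite set
of nonzero elements of `I` whose leading terms generate the ideal of leading terms of `I`. -/
def IsGroebnerBasis {σ : Type*} (m : MonomialOrder σ) (B : Finset (MvPolynomial σ ℚ))
    (I : Ideal (MvPolynomial σ ℚ)) : Prop :=
  (∀ b ∈ B, b ∈ I ∧ b ≠ 0) ∧
  Ideal.span (m.leadingTerm '' (B : Set (MvPolynomial σ ℚ))) =
    Ideal.span (m.leadingTerm '' (I : Set (MvPolynomial σ ℚ)))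

open scoped MonomialOrder in
/-- `r` is a remainder of `f` on division by `B`: `f = ∑ q_b b + r`, no leading monomial of some
`q_b b` exceeds that of `f`, and no monomial of `r` is divisible by the leading monomial of an
element of `B`. -/
def IsRemainder {σ : Type*} (m : MonomialOrder σ) (B : Finset (MvPolynomial σ ℚ))
    (f r : MvPolynomial σ ℚ) : Prop :=
  (∃ q : MvPolynomial σ ℚ → MvPolynomial σ ℚ,
    f = (∑ b ∈ B, q b * b) + r ∧ ∀ b ∈ B, m.degree (q b * b) ≼[m] m.degree f) ∧
  ∀ c ∈ r.support, ∀ b ∈ B, ¬ m.degree b ≤ c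

/-- `r` is a remainder on division by `B ⊆ ℚ[T]` of the polynomial `f` with parameters `T`.
As `B` does not involve the other indeterminates, the division takes place in the coefficients
in `ℚ[T]` of each monomial in these indeterminates. -/
def IsParamRemainder {n : ℕ} {σ : Type*} (m : MonomialOrder (Triple n))
    (B : Finset (ParamRing n)) (f r : MvPolynomial σ (ParamRing n)) : Prop :=
  ∀ d : σ →₀ ℕ, IsRemainder m B (MvPolynomial.coeff d f) (MvPolynomial.coeff d r)

end NilpotentHall

/-! Every element of I_n(T) vanishes on C_n. For t in C_n normal forms in G(t) are unique
(`normalWord_gen_injective`), so associativity of G(t) makes P(t; x, y, w) vanish at all integer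
points, hence identically in x, y, w (`map_associator_eq_zero`). Division by B ⊆ I_n(T) changes
coefficients only by elements of I_n(T), so values at t survive (`IsParamRemainder.evalAt_eq`);
remainders are unique because B is a Gröbner basis.

Unique normal forms come from Hirsch length n: the subgroups of words in a_i, ..., a_n form a series
with n cyclic factors, and a finite factor would bound the number of infinite factors in any series
by less than n. A height function on subgroups proves this bound directly.

Existence of F and K is symbolic collection (`IsPolyNilpotent.closed`), carried out for families of
group elements over a parameter set V with exponents in an algebra of functions on V. A power or
conjugate with variable exponent is handled by adding an integer variable k: the result satisfies
g(k+1) = g(k) w(k), and its leading exponent is a polynomial antidifference. The recursion runs over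
all integers, so the relations conjugating by a_i alone also control conjugation by its inverse. -/

namespace NilpotentHall

universe u w

/-! ### Symbolic collection over a parameter space -/

section PolynomialSections

variable {V : Type u} {ι : Type*}

/-- Evaluation at a point, on an algebra of functions. -/
def pointEval (A : Subalgebra ℚ (V → ℚ)) (v : V) : A →+* ℚ :=
  (Pi.evalRingHom (fun _ : V => ℚ) v).comp A.val.toRingHom

@[simp] lemma pointEval_apply (A : Subalgebra ℚ (V → ℚ)) (v : V) (f : A) :
    pointEval A v f = (f : V → ℚ) v := rfl

/-- The functions on `V × ℤ` that are polynomials in the second coordinate with coefficients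
in `A`. -/
def adjoinInt (A : Subalgebra ℚ (V → ℚ)) : Subalgebra ℚ (V × ℤ → ℚ) where
  carrier := {f | ∃ p : Polynomial A, ∀ v k, f (v, k) = p.eval₂ (pointEval A v) (k : ℚ)}
  mul_mem' := by
    rintro f g ⟨p, hp⟩ ⟨q, hq⟩
    exact ⟨p * q, fun v k => by simp [hp, hq, Polynomial.eval₂_mul]⟩
  add_mem' := by
    rintro f g ⟨p, hp⟩ ⟨q, hq⟩
    exact ⟨p + q, fun v k => by simp [hp, hq, Polynomial.eval₂_add]⟩
  algebraMap_mem' r :=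
    ⟨Polynomial.C (algebraMap ℚ A r), fun v k => by
      simp only [Polynomial.eval₂_C, pointEval_apply]; rfl⟩

lemma comp_fst_mem_adjoinInt {A : Subalgebra ℚ (V → ℚ)} {f : V → ℚ} (hf : f ∈ A) :
    f ∘ Prod.fst ∈ adjoinInt A :=
  ⟨Polynomial.C ⟨f, hf⟩, fun v k => by simp⟩

lemma snd_mem_adjoinInt (A : Subalgebra ℚ (V → ℚ)) :
    (fun p : V × ℤ => (p.2 : ℚ)) ∈ adjoinInt A :=
  ⟨Polynomial.X, fun v k => by simp⟩

/-- Specialising the auxiliary variable k to e amounts to evaluating a polynomial over `A` at an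
element of `A`. -/
lemma comp_graph_mem {A : Subalgebra ℚ (V → ℚ)} {e : V → ℤ} (he : (fun v => (e v : ℚ)) ∈ A)
    {f : V × ℤ → ℚ} (hf : f ∈ adjoinInt A) : f ∘ (fun v => (v, e v)) ∈ A := by
  obtain ⟨p, hp⟩ := hf
  have : f ∘ (fun v => (v, e v)) = ((p.eval ⟨_, he⟩ : A) : V → ℚ) := by
    funext v
    rw [Function.comp_apply, hp, ← pointEval_apply A v, Polynomial.eval, Polynomial.hom_eval₂]
    rfl
  rw [this]
  exact Subtype.prop _

/-- A polynomial in one integer variable has a polynomial antidifference. -/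
lemma exists_antidifference {A : Subalgebra ℚ (V → ℚ)} {f : V × ℤ → ℚ} (hf : f ∈ adjoinInt A) :
    ∃ g ∈ adjoinInt A, ∀ v, g (v, 0) = 0 ∧ ∀ k, g (v, k + 1) = g (v, k) + f (v, k) := by
  obtain ⟨p, hp⟩ := hf
  induction p using Polynomial.induction_on' generalizing f with
  | add p q ihp ihq =>
    obtain ⟨g, hg, hg'⟩ :=
      ihp (f := fun x => p.eval₂ (pointEval A x.1) (x.2 : ℚ)) fun _ _ => rfl
    obtain ⟨h, hh, hh'⟩ :=
      ihq (f := fun x => q.eval₂ (pointEval A x.1) (x.2 : ℚ)) fun _ _ => rfl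
    refine ⟨g + h, add_mem hg hh, fun v => ⟨by simp [hg' v, hh' v], fun k => ?_⟩⟩
    simp only [Pi.add_apply, (hg' v).2, (hh' v).2, hp, Polynomial.eval₂_add]
    ring
  | monomial d c =>
    -- B_{d+1}(k+1) - B_{d+1}(k) = (d+1) k^d, so normalising the Bernoulli polynomial at 0 and
    -- dividing by d+1 sums k^d.
    let b : ℚ → ℚ := fun x => (Polynomial.bernoulli (d + 1)).eval x
    refine ⟨fun x => (c : V → ℚ) x.1 * ((b x.2 - b 0) / (d + 1)), ?_, fun v => ⟨by simp, ?_⟩⟩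
    · refine ⟨Polynomial.C (c * algebraMap ℚ A (1 / (d + 1))) *
        ((Polynomial.bernoulli (d + 1)).map (algebraMap ℚ A) -
          Polynomial.C (algebraMap ℚ A (b 0))), fun v k => ?_⟩
      have key : ∀ r : ℚ, pointEval A v (algebraMap ℚ A r) = r := fun r => rfl
      have key' : (pointEval A v).comp (algebraMap ℚ A) = RingHom.id ℚ := RingHom.ext key
      rw [Polynomial.eval₂_mul, Polynomial.eval₂_sub, Polynomial.eval₂_map, Polynomial.eval₂_C,
        Polynomial.eval₂_C, map_mul, key, key, key', pointEval_apply]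
      simp only [b, Polynomial.eval]
      ring
    · intro k
      have h := Polynomial.bernoulli_eval_one_add (d + 1) (k : ℚ)
      have hd : (d : ℚ) + 1 ≠ 0 := by positivity
      simp only [hp, Polynomial.eval₂_monomial, pointEval_apply, b, Int.cast_add, Int.cast_one,
        add_comm (k : ℚ) 1, h, Nat.add_sub_cancel]
      push_cast
      field_simp
      ring

lemma intCast_const_mem (A : Subalgebra ℚ (V → ℚ)) (m : ℤ) : (fun _ : V => (m : ℚ)) ∈ A :=
  A.algebraMap_mem (m : ℚ)

/-- The antidifference may have non-integral coefficients, but it starts at 0 and has integer steps,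
so induction in both directions gives integer values. -/
lemma exists_int_antidifference {A : Subalgebra ℚ (V → ℚ)} {f : V × ℤ → ℤ}
    (hf : (fun x => (f x : ℚ)) ∈ adjoinInt A) :
    ∃ g : V × ℤ → ℤ, (fun x => (g x : ℚ)) ∈ adjoinInt A ∧
      ∀ v, g (v, 0) = 0 ∧ ∀ k, g (v, k + 1) = g (v, k) + f (v, k) := by
  obtain ⟨g, hg, h⟩ := exists_antidifference hf
  have hint : ∀ x : V × ℤ, ∃ m : ℤ, g x = m := by
    rintro ⟨v, k⟩
    induction k using Int.induction_on with
    | zero => exact ⟨0, by simpa using (h v).1⟩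
    | succ i ih =>
      obtain ⟨m, hm⟩ := ih
      exact ⟨m + f (v, i), by rw [(h v).2, hm]; push_cast; rfl⟩
    | pred i ih =>
      obtain ⟨m, hm⟩ := ih
      refine ⟨m - f (v, -i - 1), ?_⟩
      have := (h v).2 (-i - 1)
      rw [sub_add_cancel, hm] at this
      push_cast
      linarith
  choose e he using hint
  simp only [he] at h
  exact ⟨e, funext he ▸ hg,
    fun v => ⟨by exact_mod_cast (h v).1, fun k => by exact_mod_cast (h v).2 k⟩⟩

variable {G : V → Type w} [∀ v, Group (G v)]

/-- The sections `v ↦ ∏ a_i(v) ^ e_i(v)`, where `i` runs through `L` and the `e_i` are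
integer-valued functions in `A`. -/
def polyWords (A : Subalgebra ℚ (V → ℚ)) (a : ι → ∀ v, G v) : List ι → Set (∀ v, G v)
  | [] => {1}
  | i :: L => {g | ∃ e : V → ℤ, (fun v => (e v : ℚ)) ∈ A ∧
      ∃ h ∈ polyWords A a L, ∀ v, g v = a i v ^ e v * h v}

/-- Conjugation by `b` maps each generator `a_j` in `L` to the product of `a_j` and a polynomial
word in the later generators. -/
def ActsUnipotently (A : Subalgebra ℚ (V → ℚ)) (a : ι → ∀ v, G v) (b : ∀ v, G v) :
    List ι → Prop
  | [] => True
  | j :: L => (∃ w ∈ polyWords A a L, ∀ v, (b v)⁻¹ * a j v * b v = a j v * w v) ∧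
      ActsUnipotently A a b L

/-- Each generator acts unipotently on the later ones. -/
def IsPolyNilpotent (A : Subalgebra ℚ (V → ℚ)) (a : ι → ∀ v, G v) : List ι → Prop
  | [] => True
  | i :: L => ActsUnipotently A a (a i) L ∧ IsPolyNilpotent A a L

lemma polyWords_comp {W : Type*} {A : Subalgebra ℚ (V → ℚ)} {B : Subalgebra ℚ (W → ℚ)}
    {φ : W → V} (hφ : ∀ f ∈ A, f ∘ φ ∈ B) {a : ι → ∀ v, G v} {L : List ι} {g : ∀ v, G v}
    (hg : g ∈ polyWords A a L) :
    (fun w => g (φ w)) ∈ polyWords B (fun i w => a i (φ w)) L := by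
  induction L generalizing g with
  | nil => simp only [polyWords, Set.mem_singleton_iff] at hg ⊢; subst hg; rfl
  | cons i L ih =>
    obtain ⟨e, he, h, hh, hgh⟩ := hg
    exact ⟨fun w => e (φ w), hφ _ he, _, ih hh, fun w => hgh (φ w)⟩

lemma ActsUnipotently.comp {W : Type*} {A : Subalgebra ℚ (V → ℚ)} {B : Subalgebra ℚ (W → ℚ)}
    {φ : W → V} (hφ : ∀ f ∈ A, f ∘ φ ∈ B) {a : ι → ∀ v, G v} {b : ∀ v, G v} {L : List ι}
    (h : ActsUnipotently A a b L) :
    ActsUnipotently B (fun i w => a i (φ w)) (fun w => b (φ w)) L := by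
  induction L with
  | nil => trivial
  | cons j L ih =>
    obtain ⟨⟨w, hw, hc⟩, h⟩ := h
    exact ⟨⟨_, polyWords_comp hφ hw, fun x => hc (φ x)⟩, ih h⟩

lemma IsPolyNilpotent.comp {W : Type*} {A : Subalgebra ℚ (V → ℚ)} {B : Subalgebra ℚ (W → ℚ)}
    {φ : W → V} (hφ : ∀ f ∈ A, f ∘ φ ∈ B) {a : ι → ∀ v, G v} {L : List ι}
    (h : IsPolyNilpotent A a L) : IsPolyNilpotent B (fun i w => a i (φ w)) L := by
  induction L with
  | nil => trivial
  | cons j L ih => exact ⟨h.1.comp hφ, ih h.2⟩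

lemma one_mem_polyWords (A : Subalgebra ℚ (V → ℚ)) (a : ι → ∀ v, G v) (L : List ι) :
    (1 : ∀ v, G v) ∈ polyWords A a L := by
  induction L with
  | nil => rfl
  | cons i L ih => exact ⟨fun _ => 0, intCast_const_mem A 0, 1, ih, fun v => by simp⟩

lemma polyWords_subset_cons (A : Subalgebra ℚ (V → ℚ)) (a : ι → ∀ v, G v) (i : ι) (L : List ι) :
    polyWords A a L ⊆ polyWords A a (i :: L) :=
  fun g hg => ⟨fun _ => 0, intCast_const_mem A 0, g, hg, fun v => by simp⟩

/-- Sections over `V × ℤ` that satisfy the recursion of an ordered product of polynomial words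
are polynomial words. -/
def ClosedUnderProducts (A : Subalgebra ℚ (V → ℚ)) (a : ι → ∀ v, G v) (L : List ι) : Prop :=
  ∀ w ∈ polyWords (G := fun x : V × ℤ => G x.1) (adjoinInt A) (fun i x => a i x.1) L,
    ∀ g : ∀ x : V × ℤ, G x.1, (∀ v, g (v, 0) = 1) →
      (∀ v k, g (v, k + 1) = g (v, k) * w (v, k)) →
      g ∈ polyWords (G := fun x : V × ℤ => G x.1) (adjoinInt A) (fun i x => a i x.1) L

/-- Conjugation by powers of a unipotently acting section preserves polynomial words. -/
def ClosedUnderConj (A : Subalgebra ℚ (V → ℚ)) (a : ι → ∀ v, G v) (L : List ι) : Prop :=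
  ∀ b : ∀ v, G v, ActsUnipotently A a b L → ∀ e : V → ℤ, (fun v => (e v : ℚ)) ∈ A →
    ∀ g ∈ polyWords A a L, (fun v => (b v ^ e v)⁻¹ * g v * b v ^ e v) ∈ polyWords A a L

/-- Powers with exponents in `A` of polynomial words are polynomial words. -/
lemma ClosedUnderProducts.zpow_mem {A : Subalgebra ℚ (V → ℚ)} {a : ι → ∀ v, G v} {L : List ι}
    (H : ClosedUnderProducts A a L) {g : ∀ v, G v} (hg : g ∈ polyWords A a L) {e : V → ℤ}
    (he : (fun v => (e v : ℚ)) ∈ A) : (fun v => g v ^ e v) ∈ polyWords A a L :=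
  polyWords_comp (G := fun x : V × ℤ => G x.1) (φ := fun v => (v, e v))
    (fun _ hf => comp_graph_mem he hf)
    (H _ (polyWords_comp (φ := Prod.fst) (fun _ hf => comp_fst_mem_adjoinInt hf) hg)
      (fun x => g x.1 ^ x.2) (fun _ => zpow_zero _) fun _ _ => zpow_add_one _ _)

/-- Collect to the left: a^e g' · a^f h' = a^(e+f) · (a^(-f) g' a^f) h'. -/
lemma polyWords_mul_cons {A : Subalgebra ℚ (V → ℚ)} {a : ι → ∀ v, G v} {i : ι} {L : List ι}
    (hM : ∀ g ∈ polyWords A a L, ∀ h ∈ polyWords A a L, g * h ∈ polyWords A a L)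
    (hC : ClosedUnderConj A a L) (hi : ActsUnipotently A a (a i) L) :
    ∀ g ∈ polyWords A a (i :: L), ∀ h ∈ polyWords A a (i :: L),
      g * h ∈ polyWords A a (i :: L) := by
  rintro g ⟨e, he, g', hg', hg⟩ h ⟨f, hf, h', hh', hh⟩
  refine ⟨e + f, ?_, _, hM _ (hC _ hi f hf g' hg') _ hh', fun v => ?_⟩
  · refine (congrArg (· ∈ A) (funext fun v => ?_)).mp (add_mem he hf)
    simp
  simp only [Pi.mul_apply, Pi.add_apply, hg, hh, zpow_add]
  group

/-- With w = a^p w' and s an antidifference of p, the section g a^(-s) satisfies the recursion with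
factor a^(s+p) w' a^(-(s+p)), a word in `L`. This exponent depends on k, hence conjugation is needed
over `V × ℤ`. -/
lemma ClosedUnderProducts.cons {A : Subalgebra ℚ (V → ℚ)} {a : ι → ∀ v, G v} {i : ι} {L : List ι}
    (hS : ClosedUnderProducts A a L)
    (hC : ClosedUnderConj (G := fun x : V × ℤ => G x.1) (adjoinInt A) (fun i x => a i x.1) L)
    (hi : ActsUnipotently A a (a i) L) : ClosedUnderProducts A a (i :: L) := by
  rintro w ⟨p, hp, w', hw', hw⟩ g hg0 hg
  obtain ⟨s, hs, hs'⟩ := exists_int_antidifference hp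
  have hi' := hi.comp (B := adjoinInt A) (φ := Prod.fst) fun f hf => comp_fst_mem_adjoinInt hf
  have hneg : (fun x => ((-(s x + p x) : ℤ) : ℚ)) ∈ adjoinInt A := by
    have := neg_mem (add_mem hs hp)
    refine (congrArg (· ∈ adjoinInt A) (funext fun x => ?_)).mp this
    simp
  have h1 := hS _ (hC _ hi' _ hneg _ hw') (fun x => g x * (a i x.1 ^ s x)⁻¹)
    (fun v => by simp [hg0, hs']) fun v k => by
      simp only [hg, hw, (hs' v).2, zpow_add, zpow_neg]
      group
  -- Move a^s to the front: (g a^(-s)) a^s = a^s · a^(-s) (g a^(-s)) a^s.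
  refine ⟨s, hs, _, hC _ hi' s hs _ h1, fun v => ?_⟩
  group

/-- If b⁻¹ a b = a w, then the commutator a⁻¹ b^(-k) a b^k gains the right factor b^(-k) w b^k when
k increases by 1. It is therefore a word in `L`, polynomial in k, and k can be specialised to `e`.
-/
lemma ClosedUnderConj.cons {A : Subalgebra ℚ (V → ℚ)} {a : ι → ∀ v, G v} {i : ι} {L : List ι}
    (hS : ClosedUnderProducts A a L)
    (hC : ClosedUnderConj A a L)
    (hC' : ClosedUnderConj (G := fun x : V × ℤ => G x.1) (adjoinInt A) (fun i x => a i x.1) L)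
    (hM : ∀ g ∈ polyWords A a (i :: L), ∀ h ∈ polyWords A a (i :: L),
      g * h ∈ polyWords A a (i :: L))
    (hS' : ClosedUnderProducts A a (i :: L)) : ClosedUnderConj A a (i :: L) := by
  rintro b ⟨⟨w, hw, hbw⟩, hb⟩ e he g ⟨f, hf, g', hg', hg⟩
  have hb' := hb.comp (B := adjoinInt A) (φ := Prod.fst) fun f hf => comp_fst_mem_adjoinInt hf
  have hw' := polyWords_comp (B := adjoinInt A) (φ := Prod.fst)
    (fun f hf => comp_fst_mem_adjoinInt hf) hw
  have h1 := hS _ (hC' _ hb' (fun x => x.2) (snd_mem_adjoinInt A) _ hw')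
    (fun x => (a i x.1)⁻¹ * (b x.1 ^ x.2)⁻¹ * a i x.1 * b x.1 ^ x.2) (fun v => by simp)
    fun v k => by
      have h2 : (b v ^ (k + 1))⁻¹ * a i v * b v ^ (k + 1) =
          (b v ^ k)⁻¹ * ((b v)⁻¹ * a i v * b v) * b v ^ k := by
        rw [zpow_add_one, (Commute.zpow_self (b v) k).eq]
        group
      rw [hbw] at h2
      have h3 : (a i v)⁻¹ * (b v ^ (k + 1))⁻¹ * a i v * b v ^ (k + 1) =
          (a i v)⁻¹ * ((b v ^ (k + 1))⁻¹ * a i v * b v ^ (k + 1)) := by group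
      simp only [h3, h2]
      group
  have h2 := polyWords_comp (G := fun x : V × ℤ => G x.1) (φ := fun v => (v, e v))
    (fun f hf => comp_graph_mem he hf) h1
  have h3 : (fun v => (b v ^ e v)⁻¹ * a i v * b v ^ e v) ∈ polyWords A a (i :: L) :=
    ⟨fun _ => 1, intCast_const_mem A 1, _, h2, fun v => by simp [mul_assoc]⟩
  have h4 := hM _ (hS'.zpow_mem h3 hf) _
    (polyWords_subset_cons A a i L (hC _ hb e he _ hg'))
  refine (congrArg (· ∈ polyWords A a (i :: L)) (funext fun v => ?_)).mp h4
  have h5 : ((b v ^ e v)⁻¹ * a i v * b v ^ e v) ^ f v =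
      (b v ^ e v)⁻¹ * a i v ^ f v * b v ^ e v := by
    simpa using conj_zpow (a := (b v ^ e v)⁻¹) (b := a i v) (i := f v)
  simp only [Pi.mul_apply, hg, h5]
  group

/-- Collection: polynomial words are closed under products and conjugation. -/
theorem IsPolyNilpotent.closed (L : List ι) : ∀ {V : Type u} {G : V → Type w} [∀ v, Group (G v)]
    {A : Subalgebra ℚ (V → ℚ)} {a : ι → ∀ v, G v}, IsPolyNilpotent A a L →
      (∀ g ∈ polyWords A a L, ∀ h ∈ polyWords A a L, g * h ∈ polyWords A a L) ∧
      ClosedUnderProducts A a L ∧ ClosedUnderConj A a L := by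
  induction L with
  | nil =>
    intro V G _ A a _
    refine ⟨?_, ?_, ?_⟩
    · rintro _ rfl _ rfl
      exact mul_one _
    · rintro _ rfl g hg0 hg
      refine funext fun ⟨v, k⟩ => ?_
      induction k using Int.induction_on with
      | zero => exact hg0 v
      | succ k ih => rw [hg, ih]; exact mul_one _
      | pred k ih =>
        have := hg v (-k - 1)
        rw [sub_add_cancel, ih] at this
        simpa using this.symm
    · rintro b - e he _ rfl
      exact funext fun v => by simp
  | cons i L ih =>
    intro V G _ A a h
    obtain ⟨hM, hS, hC⟩ := ih h.2
    have h' := h.2.comp (B := adjoinInt A) (φ := Prod.fst) fun f hf => comp_fst_mem_adjoinInt hf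
    -- The inductive hypothesis is used over `V × ℤ`; this is why the base is quantified inside the
    -- induction.
    have hC' := (ih h').2.2
    have hM' := polyWords_mul_cons hM hC h.1
    have hS' := hS.cons hC' h.1
    exact ⟨hM', hS', hC.cons hS hC' hM' hS'⟩

end PolynomialSections

/-! ### Bounding the number of infinite cyclic factors -/

section HirschLength

/-- A bound for the number of infinite steps in chains of subgroups, given by a height function. -/
def HasHeightBound (G : Type*) [Group G] (h : ℕ) : Prop :=
  ∃ d : Subgroup G → ℕ, Monotone d ∧ (∀ K, d K ≤ h) ∧
    ∀ K' K, K' ≤ K → K'.relIndex K = 0 → d K' < d K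

/-- A nontrivial element of `P` is c^e with e ≠ 0 for a generator c, so c has finite order modulo
`P`. -/
lemma index_ne_zero_of_infinite {C : Type*} [Group C] [IsCyclic C] (P : Subgroup C) [Infinite P] :
    P.index ≠ 0 := by
  let _ : CommGroup C := IsCyclic.commGroup
  obtain ⟨c, hc⟩ := IsCyclic.exists_generator (α := C)
  obtain ⟨⟨x, hx⟩, hx1⟩ := exists_ne (1 : P)
  obtain ⟨e, rfl⟩ := Subgroup.mem_zpowers_iff.mp (hc x)
  have he : e ≠ 0 := by
    rintro rfl
    exact hx1 (by ext; simp)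
  have hfin : IsOfFinOrder (QuotientGroup.mk c : C ⧸ P) := by
    refine isOfFinOrder_iff_zpow_eq_one.mpr ⟨e, he, ?_⟩
    rw [← QuotientGroup.mk_zpow, QuotientGroup.eq_one_iff]
    exact hx
  have hgen : ∀ q : C ⧸ P, q ∈ Subgroup.zpowers (QuotientGroup.mk c : C ⧸ P) := by
    intro q
    obtain ⟨y, rfl⟩ := QuotientGroup.mk_surjective q
    obtain ⟨k, rfl⟩ := Subgroup.mem_zpowers_iff.mp (hc y)
    exact Subgroup.mem_zpowers_iff.mpr ⟨k, by simp⟩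
  rw [Subgroup.index, ← orderOf_eq_card_of_forall_mem_zpowers hgen]
  exact hfin.orderOf_pos.ne'

/-- Every coset of P in NP has a representative in N; `P` need not be normal. -/
lemma relIndex_sup_left_of_normal {G : Type*} [Group G] (P N : Subgroup G) [N.Normal] :
    P.relIndex (N ⊔ P) = P.relIndex N := by
  refine (Nat.card_congr (Equiv.ofBijective
    (Subgroup.quotientSubgroupOfEmbeddingOfLE P (le_sup_left : N ≤ N ⊔ P))
    ⟨Function.Embedding.injective _, fun q => ?_⟩)).symm
  obtain ⟨⟨g, hg⟩, rfl⟩ := QuotientGroup.mk_surjective q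
  obtain ⟨k, hk, p, hp, rfl⟩ := Subgroup.mem_sup_of_normal_left.mp hg
  refine ⟨QuotientGroup.mk ⟨k, hk⟩, ?_⟩
  rw [Subgroup.quotientSubgroupOfEmbeddingOfLE_apply_mk, QuotientGroup.eq]
  simpa [Subgroup.mem_subgroupOf] using hp

/-- The index of K' in K is the product of the indices taken in the kernel of f on K and in the
image f(K). -/
lemma relIndex_ne_zero_of_map {G C : Type*} [Group G] [Group C] (f : G →* C) {K' K : Subgroup G}
    (hle : K' ≤ K) (h1 : K'.relIndex (K ⊓ f.ker) ≠ 0) (h2 : (K'.map f).relIndex (K.map f) ≠ 0) :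
    K'.relIndex K ≠ 0 := by
  let F := f.comp K.subtype
  let P := K'.subgroupOf K
  have hker : F.ker = f.ker.subgroupOf K := by
    ext x
    simp [F, Subgroup.mem_subgroupOf, MonoidHom.mem_ker]
  have hP : P.relIndex F.ker ≠ 0 := by
    have : P.relIndex F.ker = K'.relIndex (K ⊓ f.ker) := by
      change (K'.comap K.subtype).relIndex F.ker = _
      rw [Subgroup.relIndex_comap, hker, Subgroup.subgroupOf_map_subtype, inf_comm]
    rwa [this]
  have hmap : (F.ker ⊔ P).index ≠ 0 := by
    have e1 : K'.map f = P.map F := by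
      rw [← Subgroup.map_map, Subgroup.subgroupOf_map_subtype, inf_eq_left.mpr hle]
    have e2 : K.map f = (⊤ : Subgroup K).map F := by
      rw [← Subgroup.map_map, ← MonoidHom.range_eq_map, Subgroup.range_subtype]
    rwa [e1, e2, Subgroup.relIndex_map_map, top_sup_eq, Subgroup.relIndex_top_right,
      sup_comm] at h2
  change P.index ≠ 0
  rw [← Subgroup.relIndex_mul_index (le_sup_right : P ≤ F.ker ⊔ P), relIndex_sup_left_of_normal]
  exact mul_ne_zero hP hmap

open scoped Classical in
-- The height of K is that of its preimage in N, plus 1 if its image in C is infinite. If neither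
-- term drops from K to K', both the kernel part and the image part have finite index.
lemma HasHeightBound.extension {N G C : Type*} [Group N] [Group G] [Group C] [IsCyclic C]
    {h : ℕ} (hN : HasHeightBound N h) (j : N →* G) (f : G →* C) (hjf : j.range = f.ker) :
    HasHeightBound G (h + if Infinite C then 1 else 0) := by
  obtain ⟨d, hmono, hbound, hstrict⟩ := hN
  let δ : Subgroup G → ℕ := fun K => if Infinite (K.map f) then 1 else 0
  have hδ : Monotone δ := by
    intro K' K hle
    by_cases hi : Infinite (K'.map f)
    · have : Infinite (K.map f) :=
        Infinite.of_injective _ (Subgroup.inclusion_injective (Subgroup.map_mono (f := f) hle))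
      simp only [δ, if_pos hi, if_pos this, le_rfl]
    · simp only [δ, if_neg hi, Nat.zero_le]
  have hd : Monotone fun K : Subgroup G => d (K.comap j) :=
    fun K' K hle => hmono (Subgroup.comap_mono hle)
  refine ⟨fun K => d (K.comap j) + δ K, hd.add hδ, fun K => ?_, fun K' K hle h0 => ?_⟩
  · refine add_le_add (hbound _) ?_
    by_cases hi : Infinite (K.map f)
    · have : Infinite C := Infinite.of_injective _ (K.map f).subtype_injective
      simp only [δ, if_pos hi, if_pos this, le_rfl]
    · simp only [δ, if_neg hi, Nat.zero_le]
  · by_contra hlt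
    have h1 := hd hle
    have h2 := hδ hle
    simp only at h1 hlt
    have h3 : ¬ d (K'.comap j) < d (K.comap j) := by omega
    have h4 : δ K' = δ K := by omega
    refine relIndex_ne_zero_of_map f hle (fun hz => h3 (hstrict _ _ (Subgroup.comap_mono hle) ?_))
      ?_ h0
    · rw [Subgroup.relIndex_comap, Subgroup.map_comap_eq, hjf, inf_comm, hz]
    · by_cases hi : Infinite (K'.map f)
      · exact fun hz => index_ne_zero_of_infinite (K'.map f)
          (Nat.eq_zero_of_zero_dvd (hz ▸ Subgroup.relIndex_dvd_index_of_le (Subgroup.map_mono hle)))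
      · have hi' : ¬ Infinite (K.map f) := by
          intro hK
          simp only [δ, if_neg hi, if_pos hK, zero_ne_one] at h4
        have : Finite (K.map f) := not_infinite_iff_finite.mp hi'
        exact fun hz => Nat.card_pos.ne'
          (Nat.eq_zero_of_zero_dvd (hz ▸ Subgroup.relIndex_dvd_card _ _))

lemma card_add_le_of_strict {r : ℕ} (f : Fin (r + 1) → ℕ) (p : Fin r → Prop) [DecidablePred p]
    (h1 : ∀ i, f (Fin.succ i) ≤ f (Fin.castSucc i))
    (h2 : ∀ i, p i → f (Fin.succ i) < f (Fin.castSucc i)) :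
    (∑ i, if p i then 1 else 0) + f (Fin.last r) ≤ f 0 := by
  induction r with
  | zero => simp
  | succ r ih =>
    have h3 := ih (fun i => f i.castSucc) (fun i => p i.castSucc)
      (fun i => h1 i.castSucc) (fun i => h2 i.castSucc)
    rw [Fin.sum_univ_castSucc]
    have h4 := h1 (Fin.last r)
    have h5 := h2 (Fin.last r)
    simp only [Fin.succ_last, Fin.castSucc_zero, Nat.succ_eq_add_one] at h3 h4 h5 ⊢
    split_ifs with hp
    · have := h5 hp
      omega
    · omega

lemma HasHeightBound.hirschLength_le {G : Type*} [Group G] {h n : ℕ} (hG : HasHeightBound G h)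
    (hn : HasHirschLength G n) : n ≤ h := by
  classical
  obtain ⟨d, hmono, hbound, hstrict⟩ := hG
  obtain ⟨r, H, -, -, hH, rfl⟩ := hn
  have := card_add_le_of_strict (fun i => d (H i))
    (fun i => Infinite (H i.castSucc ⧸ (H i.succ).subgroupOf (H i.castSucc)))
    (fun i => hmono (hH i).1) fun i hi => hstrict _ _ (hH i).1 Nat.card_eq_zero_of_infinite
  rw [Nat.card_eq_fintype_card, Fintype.card_subtype, Finset.card_filter]
  exact (Nat.le_add_right _ _).trans (this.trans (hbound _))

end HirschLength

/-! ### Words at a fixed parameter and uniqueness of exponents -/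

section WordSubgroup

variable {ι : Type*} {Γ : Type w} [Group Γ]

/-- The subgroup of all words `∏ a_i ^ x_i`, where `i` runs through `L`. -/
def wordSubgroup (a : ι → Γ) (L : List ι)
    (h : IsPolyNilpotent (⊤ : Subalgebra ℚ (Unit → ℚ)) (fun i _ => a i) L) : Subgroup Γ where
  carrier := {g | (fun _ => g) ∈ polyWords (⊤ : Subalgebra ℚ (Unit → ℚ)) (fun i _ => a i) L}
  one_mem' := one_mem_polyWords _ _ _
  mul_mem' hg hh := (IsPolyNilpotent.closed L h).1 _ hg _ hh
  inv_mem' {g} hg := by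
    have := (IsPolyNilpotent.closed L h).2.1.zpow_mem hg (intCast_const_mem _ (-1))
    simpa using this

/-- Over a one-point base with the full function algebra, polynomiality of exponents is no
restriction. -/
lemma mem_wordSubgroup_cons {a : ι → Γ} {i : ι} {L : List ι}
    (h : IsPolyNilpotent (⊤ : Subalgebra ℚ (Unit → ℚ)) (fun i _ => a i) (i :: L)) {g : Γ} :
    g ∈ wordSubgroup a (i :: L) h ↔ ∃ e : ℤ, ∃ g' ∈ wordSubgroup a L h.2, g = a i ^ e * g' := by
  constructor
  · rintro ⟨e, -, g', hg', hg⟩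
    exact ⟨e (), g' (), hg', hg ()⟩
  · rintro ⟨e, g', hg', hg⟩
    exact ⟨fun _ => e, trivial, _, hg', fun _ => hg⟩

lemma conj_mem_wordSubgroup {a : ι → Γ} {i : ι} {L : List ι}
    (h : IsPolyNilpotent (⊤ : Subalgebra ℚ (Unit → ℚ)) (fun i _ => a i) (i :: L)) {g : Γ}
    (hg : g ∈ wordSubgroup a L h.2) (e : ℤ) :
    (a i ^ e)⁻¹ * g * a i ^ e ∈ wordSubgroup a L h.2 :=
  (IsPolyNilpotent.closed L h.2).2.2 _ h.1 (fun _ => e) trivial _ hg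

lemma wordSubgroup_normal {a : ι → Γ} {i : ι} {L : List ι}
    (h : IsPolyNilpotent (⊤ : Subalgebra ℚ (Unit → ℚ)) (fun i _ => a i) (i :: L)) :
    ((wordSubgroup a L h.2).subgroupOf (wordSubgroup a (i :: L) h)).Normal := by
  refine ⟨fun ⟨g, hg'⟩ hg ⟨b, hb⟩ => ?_⟩
  obtain ⟨e, b', hb', rfl⟩ := (mem_wordSubgroup_cons h).mp hb
  simp only [Subgroup.mem_subgroupOf] at hg ⊢
  have := conj_mem_wordSubgroup h (mul_mem (mul_mem hb' hg) (inv_mem hb')) (-e)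
  simpa [mul_assoc] using this

lemma mem_wordSubgroup_of_mem {a : ι → Γ} {L : List ι}
    (h : IsPolyNilpotent (⊤ : Subalgebra ℚ (Unit → ℚ)) (fun i _ => a i) L) {i : ι} (hi : i ∈ L) :
    a i ∈ wordSubgroup a L h := by
  induction L with
  | nil => simp at hi
  | cons j L ih =>
    rw [mem_wordSubgroup_cons]
    rcases List.mem_cons.mp hi with rfl | hi
    · exact ⟨1, 1, one_mem _, by simp⟩
    · exact ⟨0, _, ih h.2 hi, by simp⟩

lemma prod_mem_wordSubgroup {a : ι → Γ} {L : List ι}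
    (h : IsPolyNilpotent (⊤ : Subalgebra ℚ (Unit → ℚ)) (fun i _ => a i) L) (x : ι → ℤ) :
    (L.map fun i => a i ^ x i).prod ∈ wordSubgroup a L h :=
  list_prod_mem fun g hg => by
    obtain ⟨i, hi, rfl⟩ := List.mem_map.mp hg
    exact zpow_mem (mem_wordSubgroup_of_mem h hi) _

/-- Either the words in `L` have unique exponents, or the height of the subgroup of words is less
than the length of `L`. -/
lemma exists_heightBound_wordSubgroup {a : ι → Γ} {L : List ι}
    (h : IsPolyNilpotent (⊤ : Subalgebra ℚ (Unit → ℚ)) (fun i _ => a i) L) :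
    ∃ k ≤ L.length, HasHeightBound (wordSubgroup a L h) k ∧ (k = L.length → ∀ x y : ι → ℤ,
      (L.map fun i => a i ^ x i).prod = (L.map fun i => a i ^ y i).prod → ∀ i ∈ L, x i = y i) := by
  classical
  induction L with
  | nil =>
    refine ⟨0, le_rfl, ⟨fun _ => 0, monotone_const, fun _ => le_rfl, fun K' K _ h0 => ?_⟩, by simp⟩
    have : Subsingleton (wordSubgroup a [] h) :=
      ⟨fun g g' => Subtype.ext ((congrFun g.2 ()).trans (congrFun g'.2 ()).symm)⟩
    rw [Subsingleton.elim K' K, Subgroup.relIndex_self] at h0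
    simp at h0
  | cons i L ih =>
    obtain ⟨k, hk, hb, hinj⟩ := ih h.2
    let N := wordSubgroup a (i :: L) h
    let N' := wordSubgroup a L h.2
    have hle : N' ≤ N := fun g hg => (mem_wordSubgroup_cons h).mpr ⟨0, g, hg, by simp⟩
    have : (N'.subgroupOf N).Normal := wordSubgroup_normal h
    let c : N ⧸ N'.subgroupOf N :=
      QuotientGroup.mk ⟨a i, mem_wordSubgroup_of_mem h List.mem_cons_self⟩
    have hgen : ∀ q : N ⧸ N'.subgroupOf N, q ∈ Subgroup.zpowers c := by
      intro q
      obtain ⟨⟨g, hg⟩, rfl⟩ := QuotientGroup.mk_surjective q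
      obtain ⟨e, g', hg', rfl⟩ := (mem_wordSubgroup_cons h).mp hg
      refine Subgroup.mem_zpowers_iff.mpr ⟨e, ?_⟩
      rw [← QuotientGroup.mk_zpow, QuotientGroup.eq]
      simpa [Subgroup.mem_subgroupOf] using hg'
    have : IsCyclic (N ⧸ N'.subgroupOf N) := ⟨c, hgen⟩
    refine ⟨_, ?_, hb.extension (Subgroup.inclusion hle) (QuotientGroup.mk' (N'.subgroupOf N)) ?_,
      ?_⟩
    · rw [List.length_cons]
      split_ifs <;> omega
    · rw [QuotientGroup.ker_mk', Subgroup.inclusion_range]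
    · intro hlen x y hxy
      -- The bound reaches the full length only if every cyclic factor contributes 1.
      have hinf : Infinite (N ⧸ N'.subgroupOf N) := by
        by_contra hfin
        rw [if_neg hfin, List.length_cons] at hlen
        omega
      rw [if_pos hinf, List.length_cons, Nat.add_right_cancel_iff] at hlen
      simp only [List.map_cons, List.prod_cons] at hxy
      have hi : x i = y i := by
        by_contra hne
        -- Two different exponents would put a nonzero power of a_i into the next subgroup, making
        -- the infinite cyclic factor finite.
        have hmem : a i ^ (x i - y i) ∈ N' := by
          have h1 := mul_mem (prod_mem_wordSubgroup h.2 y) (inv_mem (prod_mem_wordSubgroup h.2 x))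
          refine (congrArg (· ∈ N') ?_).mp h1
          rw [sub_eq_neg_add, zpow_add, zpow_neg, mul_inv_eq_iff_eq_mul, mul_assoc, hxy,
            inv_mul_cancel_left]
        have hfin : IsOfFinOrder c := by
          refine isOfFinOrder_iff_zpow_eq_one.mpr ⟨_, sub_ne_zero.mpr hne, ?_⟩
          rw [← QuotientGroup.mk_zpow, QuotientGroup.eq_one_iff, Subgroup.mem_subgroupOf]
          exact hmem
        exact hfin.orderOf_pos.ne' (by
          rw [orderOf_eq_card_of_forall_mem_zpowers hgen, Nat.card_eq_zero_of_infinite])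
      rw [hi, mul_right_inj] at hxy
      intro l hl
      rcases List.mem_cons.mp hl with rfl | hl
      · exact hi
      · exact hinj hlen x y hxy l hl

end WordSubgroup

/-! ### Passing between words and exponent vectors -/

section Words

variable {V : Type u} {ι : Type*} {G : V → Type w} [∀ v, Group (G v)]

lemma prod_mem_polyWords {A : Subalgebra ℚ (V → ℚ)} {a : ι → ∀ v, G v} {x : ι → V → ℤ}
    (hx : ∀ i, (fun v => (x i v : ℚ)) ∈ A) (L : List ι) :
    (fun v => (L.map fun i => a i v ^ x i v).prod) ∈ polyWords A a L := by
  induction L with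
  | nil => rfl
  | cons i L ih => exact ⟨x i, hx i, _, ih, fun v => by simp⟩

lemma exists_exponents_of_mem_polyWords {A : Subalgebra ℚ (V → ℚ)} {a : ι → ∀ v, G v}
    {L : List ι} (hL : L.Nodup) {g : ∀ v, G v} (hg : g ∈ polyWords A a L) :
    ∃ x : ι → V → ℤ, (∀ i, (fun v => (x i v : ℚ)) ∈ A) ∧
      ∀ v, g v = (L.map fun i => a i v ^ x i v).prod := by
  classical
  induction L generalizing g with
  | nil =>
    refine ⟨fun _ _ => 0, fun _ => intCast_const_mem A 0, fun v => ?_⟩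
    simp only [polyWords, Set.mem_singleton_iff] at hg
    simp [hg]
  | cons i L ih =>
    obtain ⟨e, he, h, hh, hg⟩ := hg
    obtain ⟨hi, hL⟩ := List.nodup_cons.mp hL
    obtain ⟨x, hx, hxh⟩ := ih hL hh
    refine ⟨Function.update x i e, fun k => ?_, fun v => ?_⟩
    · by_cases hk : k = i
      · subst hk
        simpa using he
      · simpa [hk] using hx k
    · rw [hg, hxh, List.map_cons, List.prod_cons, Function.update_self]
      congr 2
      refine List.map_congr_left fun k hk => ?_
      rw [Function.update_of_ne]
      rintro rfl
      exact hi hk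

end Words

/-! ### The groups G(t) -/

section Presentation

variable {n : ℕ}

lemma normalWord_eq {G : Type*} [Group G] (a : Fin n → G) (x : Fin n → ℤ) :
    normalWord a x = ((List.finRange n).map fun k => a k ^ x k).prod := by
  rw [normalWord, List.ofFn_eq_map]

lemma map_normalWord {G H : Type*} [Group G] [Group H] (f : G →* H) (a : Fin n → G)
    (x : Fin n → ℤ) : f (normalWord a x) = normalWord (f ∘ a) x := by
  simp only [normalWord_eq, map_list_prod, List.map_map, Function.comp_def, map_zpow]

lemma inv_gen_mul_gen_mul_gen (t : Triple n → ℤ) {i j : Fin n} (hij : i < j) :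
    (gen t i)⁻¹ * gen t j * gen t i = gen t j * normalWord (gen t) (tailExponent t i j) := by
  have h : PresentedGroup.mk (relators t) _ = 1 :=
    PresentedGroup.one_of_mem (rels := relators t) ⟨i, j, hij, rfl⟩
  rw [map_mul, map_inv, mul_inv_eq_one, map_mul, map_mul, map_mul, map_normalWord] at h
  change gen t j * gen t i = gen t i * gen t j * normalWord (gen t) _ at h
  rw [mul_assoc, h]
  group

/-- Tail exponents vanish at all indices up to j, so only the letters after j survive. -/
lemma normalWord_tailExponent {G : Type*} [Group G] (a : Fin n → G) (t : Triple n → ℤ)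
    (i j : Fin n) {P Q : List (Fin n)} (hPQ : List.finRange n = P ++ j :: Q) :
    normalWord a (tailExponent t i j) = (Q.map fun k => a k ^ tailExponent t i j k).prod := by
  have hs := (List.sortedLT_finRange n).pairwise
  rw [hPQ, List.pairwise_append] at hs
  have hz : ∀ k, ¬ j < k → tailExponent t i j k = 0 := fun k hk =>
    dif_neg fun h => hk h.2
  have hP : (P.map fun k => a k ^ tailExponent t i j k).prod = 1 := by
    refine List.prod_eq_one fun g hg => ?_
    obtain ⟨k, hk, rfl⟩ := List.mem_map.mp hg
    rw [hz k (hs.2.2 k hk j List.mem_cons_self).asymm, zpow_zero]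
  rw [normalWord_eq, hPQ, List.map_append, List.prod_append, hP, List.map_cons, List.prod_cons,
    hz j (lt_irrefl j), zpow_zero, one_mul, one_mul]

variable {V : Type u} {A : Subalgebra ℚ (V → ℚ)} {τ : V → Triple n → ℤ}

lemma actsUnipotently_gen (hτ : ∀ s, (fun v => (τ v s : ℚ)) ∈ A) (i : Fin n)
    {P Q : List (Fin n)} (hPQ : List.finRange n = P ++ Q) (hi : i ∈ P) :
    ActsUnipotently (G := fun v => GroupOf (τ v)) A (fun k v => gen (τ v) k)
      (fun v => gen (τ v) i) Q := by
  induction Q generalizing P with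
  | nil => trivial
  | cons j Q ih =>
    have hs := (List.sortedLT_finRange n).pairwise
    rw [hPQ, List.pairwise_append] at hs
    refine ⟨⟨_, prod_mem_polyWords (x := fun k v => tailExponent (τ v) i j k) (fun k => ?_) Q,
      fun v => ?_⟩, ih (P := P ++ [j]) (by simpa using hPQ) (by simp [hi])⟩
    · unfold tailExponent
      split_ifs with h
      · exact hτ _
      · exact intCast_const_mem A 0
    · rw [inv_gen_mul_gen_mul_gen _ (hs.2.2 i hi j List.mem_cons_self),
        normalWord_tailExponent _ _ _ _ hPQ]

lemma isPolyNilpotent_gen (hτ : ∀ s, (fun v => (τ v s : ℚ)) ∈ A) :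
    IsPolyNilpotent (G := fun v => GroupOf (τ v)) A (fun k v => gen (τ v) k)
      (List.finRange n) := by
  suffices ∀ P Q : List (Fin n), List.finRange n = P ++ Q →
      IsPolyNilpotent (G := fun v => GroupOf (τ v)) A (fun k v => gen (τ v) k) Q from
    this [] _ rfl
  intro P Q
  induction Q generalizing P with
  | nil => exact fun _ => trivial
  | cons j Q ih =>
    intro hPQ
    have hPQ' : List.finRange n = (P ++ [j]) ++ Q := by simpa using hPQ
    exact ⟨actsUnipotently_gen hτ j hPQ' (by simp), ih _ hPQ'⟩

/-- In a group `G(t)` of Hirsch length `n`, normal forms are unique. -/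
theorem normalWord_gen_injective {t : Triple n → ℤ} (ht : t ∈ consistentSet n) :
    Function.Injective (normalWord (gen t)) := by
  have h : IsPolyNilpotent (⊤ : Subalgebra ℚ (Unit → ℚ)) (fun i _ => gen t i)
      (List.finRange n) := isPolyNilpotent_gen (τ := fun _ => t) fun _ => trivial
  obtain ⟨k, hk, hb, hinj⟩ := exists_heightBound_wordSubgroup h
  have htop : wordSubgroup (gen t) (List.finRange n) h = ⊤ := by
    rw [← top_le_iff, ← PresentedGroup.closure_range_of (relators t), Subgroup.closure_le]
    rintro _ ⟨i, rfl⟩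
    exact mem_wordSubgroup_of_mem h (List.mem_finRange i)
  -- An extension with trivial quotient transfers the bound from the word subgroup, which is
  -- everything, to G(t).
  have hb' := hb.extension (Subgroup.subtype _) (1 : GroupOf t →* Unit) (by
    rw [Subgroup.range_subtype, htop, MonoidHom.ker_one])
  rw [if_neg (not_infinite_iff_finite.mpr inferInstance), add_zero] at hb'
  have hkn : k = (List.finRange n).length :=
    le_antisymm hk (by simpa using hb'.hirschLength_le ht)
  intro x y hxy
  rw [normalWord_eq, normalWord_eq] at hxy
  exact funext fun i => hinj hkn x y hxy i (List.mem_finRange i)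

end Presentation

/-! ### Existence of multiplication and powering polynomials -/

section Existence

variable {n : ℕ} {σ : Type*}

/-- `evalAt` as a ring homomorphism. -/
noncomputable def evalAtHom (t : Triple n → ℤ) (v : σ → ℤ) :
    MvPolynomial σ (ParamRing n) →+* ℚ :=
  MvPolynomial.eval₂Hom (MvPolynomial.eval fun s => (t s : ℚ)) (fun s => (v s : ℚ))

lemma evalAtHom_apply (t : Triple n → ℤ) (v : σ → ℤ) (f : MvPolynomial σ (ParamRing n)) :
    evalAtHom t v f = evalAt t v f := rfl

/-- The functions `(t, v) ↦ f(t; v)` for polynomials `f` with parameters. -/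
noncomputable def paramPolyFunctions (n : ℕ) (σ : Type*) :
    Subalgebra ℚ ((Triple n → ℤ) × (σ → ℤ) → ℚ) where
  carrier := {f | ∃ p : MvPolynomial σ (ParamRing n), ∀ t v, f (t, v) = evalAt t v p}
  mul_mem' := by
    rintro f g ⟨p, hp⟩ ⟨q, hq⟩
    exact ⟨p * q, fun t v => by simp [hp, hq, ← evalAtHom_apply]⟩
  add_mem' := by
    rintro f g ⟨p, hp⟩ ⟨q, hq⟩
    exact ⟨p + q, fun t v => by simp [hp, hq, ← evalAtHom_apply]⟩
  algebraMap_mem' r :=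
    ⟨MvPolynomial.C (MvPolynomial.C r), fun t v => by simp [evalAt]⟩

lemma param_mem_paramPolyFunctions (s : Triple n) :
    (fun v : (Triple n → ℤ) × (σ → ℤ) => (v.1 s : ℚ)) ∈ paramPolyFunctions n σ :=
  ⟨MvPolynomial.C (MvPolynomial.X s), fun t v => by simp [evalAt]⟩

lemma var_mem_paramPolyFunctions (s : σ) :
    (fun v : (Triple n → ℤ) × (σ → ℤ) => (v.2 s : ℚ)) ∈ paramPolyFunctions n σ :=
  ⟨MvPolynomial.X s, fun t v => by simp [evalAt]⟩

lemma exists_polynomial_exponents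
    {g : ∀ v : (Triple n → ℤ) × (σ → ℤ), GroupOf v.1}
    (hg : g ∈ polyWords (paramPolyFunctions n σ) (fun k v => gen v.1 k) (List.finRange n)) :
    ∃ F : Fin n → MvPolynomial σ (ParamRing n), ∀ t v, ∃ e : Fin n → ℤ,
      (∀ i, evalAt t v (F i) = e i) ∧ g (t, v) = normalWord (gen t) e := by
  obtain ⟨x, hx, hgx⟩ := exists_exponents_of_mem_polyWords (List.nodup_finRange n) hg
  choose F hF using hx
  exact ⟨F, fun t v => ⟨fun i => x i (t, v), fun i => (hF i t v).symm,
    by rw [hgx, normalWord_eq]⟩⟩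

lemma normalWord_mem_polyWords (φ : Fin n → σ) :
    (fun v : (Triple n → ℤ) × (σ → ℤ) => normalWord (gen v.1) fun k => v.2 (φ k)) ∈
      polyWords (G := fun v : (Triple n → ℤ) × (σ → ℤ) => GroupOf v.1) (paramPolyFunctions n σ)
        (fun k v => gen v.1 k) (List.finRange n) := by
  simp only [normalWord_eq]
  exact prod_mem_polyWords (x := fun k (v : (Triple n → ℤ) × (σ → ℤ)) => v.2 (φ k))
    (fun i => var_mem_paramPolyFunctions (φ i)) _

theorem exists_multiplicationPolynomials (n : ℕ) :
    ∃ F : Fin n → MulRing n, IsMultiplicationPolynomials n F := by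
  have h := isPolyNilpotent_gen (n := n) (A := paramPolyFunctions n (Fin n ⊕ Fin n))
    (τ := fun v => v.1) param_mem_paramPolyFunctions
  obtain ⟨F, hF⟩ := exists_polynomial_exponents ((IsPolyNilpotent.closed _ h).1
    _ (normalWord_mem_polyWords Sum.inl) _ (normalWord_mem_polyWords Sum.inr))
  exact ⟨F, fun t _ x y => hF t (Sum.elim x y)⟩

theorem exists_poweringPolynomials (n : ℕ) :
    ∃ K : Fin n → PowRing n, IsPoweringPolynomials n K := by
  have h := isPolyNilpotent_gen (n := n) (A := paramPolyFunctions n (Fin n ⊕ Unit))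
    (τ := fun v => v.1) param_mem_paramPolyFunctions
  obtain ⟨K, hK⟩ := exists_polynomial_exponents ((IsPolyNilpotent.closed _ h).2.1.zpow_mem
    (normalWord_mem_polyWords Sum.inl) (var_mem_paramPolyFunctions (Sum.inr ())))
  exact ⟨K, fun t _ x z => hK t (Sum.elim x fun _ => z)⟩

end Existence

/-! ### Remainders modulo a Gröbner basis -/

section Division

variable {σ : Type*} {m : MonomialOrder σ} {B : Finset (MvPolynomial σ ℚ)}

lemma exists_isRemainder (hB : ∀ b ∈ B, b ≠ 0) (f : MvPolynomial σ ℚ) :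
    ∃ r, IsRemainder m B f r := by
  classical
  obtain ⟨g, r, hf, hdeg, hr⟩ := m.div_set (B := (B : Set (MvPolynomial σ ℚ)))
    (fun b hb => isUnit_iff_ne_zero.mpr (m.leadingCoeff_ne_zero_iff.mpr (hB b hb))) f
  refine ⟨r, ⟨fun b => if hb : b ∈ B then g ⟨b, hb⟩ else 0, ?_, fun b hb => ?_⟩, hr⟩
  · have hsum : Finsupp.linearCombination (MvPolynomial σ ℚ)
        (fun b : (B : Set (MvPolynomial σ ℚ)) => (b : MvPolynomial σ ℚ)) g =
        ∑ b : (B : Set (MvPolynomial σ ℚ)), g b * b := by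
      rw [Finsupp.linearCombination_apply, Finsupp.sum_fintype _ _ fun b => by exact zero_smul _ _]
      rfl
    rw [hf, hsum, ← Finset.sum_coe_sort B]
    congr 1
    exact Finset.sum_congr rfl fun b _ => by simp
  · simp only [dif_pos hb, mul_comm _ b]
    exact hdeg ⟨b, hb⟩

lemma IsRemainder.sub_mem {I : Ideal (MvPolynomial σ ℚ)} (hB : ∀ b ∈ B, b ∈ I)
    {f r : MvPolynomial σ ℚ} (h : IsRemainder m B f r) : f - r ∈ I := by
  obtain ⟨⟨q, hq, -⟩, -⟩ := h
  rw [hq, add_sub_cancel_right]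
  exact sum_mem fun b hb => I.mul_mem_left _ (hB b hb)

lemma isRemainder_zero : IsRemainder m B 0 0 :=
  ⟨⟨0, by simp, fun b _ => by simp⟩, by simp⟩

/-- If r ≠ s, the leading monomial of r - s ∈ I is divisible by that of some b ∈ B, yet it occurs in
r or in s. -/
lemma IsGroebnerBasis.isRemainder_unique {I : Ideal (MvPolynomial σ ℚ)}
    (hB : IsGroebnerBasis m B I) {f r s : MvPolynomial σ ℚ} (hr : IsRemainder m B f r)
    (hs : IsRemainder m B f s) : r = s := by
  classical
  by_contra hne
  have hmem : r - s ∈ I := by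
    have := sub_mem (hs.sub_mem fun b hb => (hB.1 b hb).1) (hr.sub_mem fun b hb => (hB.1 b hb).1)
    simpa using this
  have hlt : m.leadingTerm (r - s) ∈ Ideal.span (m.leadingTerm '' (B : Set (MvPolynomial σ ℚ))) :=
    hB.2 ▸ Ideal.subset_span ⟨_, hmem, rfl⟩
  rw [MonomialOrder.span_leadingTerm_eq_span_monomial', ← Set.image_image
    (fun s => MvPolynomial.monomial s (1 : ℚ)) m.degree,
    MvPolynomial.mem_ideal_span_monomial_image] at hlt
  have h0 : r - s ≠ 0 := sub_ne_zero.mpr hne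
  obtain ⟨_, ⟨b, hb, rfl⟩, hle⟩ := hlt (m.degree (r - s)) (by
    rw [MvPolynomial.mem_support_iff, MonomialOrder.leadingTerm, MvPolynomial.coeff_monomial,
      if_pos rfl]
    exact m.leadingCoeff_ne_zero_iff.mpr h0)
  rcases Finset.mem_union.mp (MvPolynomial.support_sub σ r s (m.degree_mem_support h0)) with h | h
  · exact hr.2 _ h b hb.1 hle
  · exact hs.2 _ h b hb.1 hle

end Division

/-! ### Coefficientwise division and evaluation on C_n -/

section ParametricDivision

variable {n : ℕ} {σ : Type*} {m : MonomialOrder (Triple n)} {B : Finset (ParamRing n)}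

lemma exists_isParamRemainder (hB : ∀ b ∈ B, b ≠ 0) (f : MvPolynomial σ (ParamRing n)) :
    ∃ r, IsParamRemainder m B f r := by
  classical
  choose R hR using exists_isRemainder (m := m) hB
  refine ⟨∑ d ∈ f.support, MvPolynomial.monomial d (R (f.coeff d)), fun d => ?_⟩
  simp only [MvPolynomial.coeff_sum, MvPolynomial.coeff_monomial, Finset.sum_ite_eq']
  split_ifs with hd
  · exact hR _
  · rw [MvPolynomial.notMem_support_iff.mp hd]
    exact isRemainder_zero

lemma existsUnique_isParamRemainder {I : Ideal (ParamRing n)} (hB : IsGroebnerBasis m B I)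
    (f : Fin n → MvPolynomial σ (ParamRing n)) :
    ∃! r : Fin n → MvPolynomial σ (ParamRing n), ∀ i, IsParamRemainder m B (f i) (r i) := by
  choose r hr using fun i => exists_isParamRemainder (m := m) (fun b hb => (hB.1 b hb).2) (f i)
  exact ⟨r, hr, fun s hs => funext fun i => MvPolynomial.ext _ _ fun d =>
    hB.isRemainder_unique (hs i d) (hr i d)⟩

lemma evalAt_eq_eval_map (t : Triple n → ℤ) (v : σ → ℤ) (f : MvPolynomial σ (ParamRing n)) :
    evalAt t v f = MvPolynomial.eval (fun s => (v s : ℚ))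
      (MvPolynomial.map (MvPolynomial.eval fun s => (t s : ℚ)) f) := by
  rw [MvPolynomial.eval_map]
  rfl

/-- Division by elements that vanish at `t` does not change the values at `t`. -/
lemma IsParamRemainder.evalAt_eq {t : Triple n → ℤ}
    (hB : ∀ b ∈ B, MvPolynomial.eval (fun s => (t s : ℚ)) b = 0)
    {f r : MvPolynomial σ (ParamRing n)} (h : IsParamRemainder m B f r) (v : σ → ℤ) :
    evalAt t v r = evalAt t v f := by
  rw [evalAt_eq_eval_map, evalAt_eq_eval_map]
  congr 1
  ext d
  rw [MvPolynomial.coeff_map, MvPolynomial.coeff_map, eq_comm, ← sub_eq_zero, ← map_sub]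
  -- The ideal containing B is here the kernel of evaluation at t.
  exact (h d).sub_mem (I := RingHom.ker (MvPolynomial.eval fun s => (t s : ℚ))) hB

lemma evalAt_substMul (t : Triple n → ℤ) (v : Fin n ⊕ Fin n ⊕ Fin n → ℤ) (F : Fin n → MulRing n)
    {p q : Fin n → AssocRing n} {x y : Fin n → ℤ} (hp : ∀ k, evalAt t v (p k) = x k)
    (hq : ∀ k, evalAt t v (q k) = y k) (i : Fin n) :
    evalAt t v (substMul F p q i) = evalMul t x y (F i) := by
  rw [← evalAtHom_apply, substMul, MvPolynomial.aeval_def, MvPolynomial.hom_eval₂, evalMul, evalAt]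
  congr 1
  · ext r <;> simp [evalAtHom]
  · funext s
    rcases s with k | k
    · simp [evalAtHom_apply, hp]
    · simp [evalAtHom_apply, hq]

/-- Multiplication polynomials are associative at consistent parameters. -/
lemma map_associator_eq_zero {F : Fin n → MulRing n} (hF : IsMultiplicationPolynomials n F)
    {t : Triple n → ℤ} (ht : t ∈ consistentSet n) (i : Fin n) :
    MvPolynomial.map (MvPolynomial.eval fun s => (t s : ℚ)) (associator F i) = 0 := by
  -- A rational polynomial vanishing at all integer points is zero.
  refine MvPolynomial.funext_set (fun _ => Set.range ((↑) : ℤ → ℚ))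
    (fun _ => Set.infinite_range_of_injective Int.cast_injective) fun a ha => ?_
  choose v hv using fun s => ha s trivial
  obtain rfl : (fun s => (v s : ℚ)) = a := funext hv
  rw [← evalAt_eq_eval_map, map_zero]
  have hX : ∀ s, evalAt t v (MvPolynomial.X s) = v s := fun s => by simp [evalAt]
  obtain ⟨e, he, hxy⟩ := hF t ht (fun k => v (Sum.inl k)) fun k => v (Sum.inr (Sum.inl k))
  obtain ⟨f, hf, hyw⟩ := hF t ht (fun k => v (Sum.inr (Sum.inl k)))
    fun k => v (Sum.inr (Sum.inr k))
  obtain ⟨e', he', hl⟩ := hF t ht e fun k => v (Sum.inr (Sum.inr k))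
  obtain ⟨f', hf', hr⟩ := hF t ht (fun k => v (Sum.inl k)) f
  -- These are the exponent vectors of (xy)w and x(yw), the same group element.
  have hef : e' = f' := normalWord_gen_injective ht (by
    rw [← hl, ← hr, ← hxy, ← hyw, mul_assoc])
  rw [← evalAtHom_apply, associator, map_sub, evalAtHom_apply, evalAtHom_apply,
    evalAt_substMul t v F (x := e) (y := fun k => v (Sum.inr (Sum.inr k))) _ fun k => hX _,
    evalAt_substMul t v F (x := fun k => v (Sum.inl k)) (y := f) (fun k => hX _),
    he', hf', hef, sub_self]
  · exact fun k => (evalAt_substMul t v F (fun k => hX _) (fun k => hX _) k).trans (hf k)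
  · exact fun k => (evalAt_substMul t v F (fun k => hX _) (fun k => hX _) k).trans (he k)

lemma eval_eq_zero_of_mem_consistencyIdeal {F : Fin n → MulRing n}
    (hF : IsMultiplicationPolynomials n F) {t : Triple n → ℤ} (ht : t ∈ consistentSet n)
    {b : ParamRing n} (hb : b ∈ consistencyIdeal F) :
    MvPolynomial.eval (fun s => (t s : ℚ)) b = 0 := by
  suffices consistencyIdeal F ≤ RingHom.ker (MvPolynomial.eval fun s => (t s : ℚ)) from this hb
  refine Ideal.span_le.mpr ?_
  rintro _ ⟨i, d, rfl⟩
  have := congrArg (MvPolynomial.coeff d) (map_associator_eq_zero hF ht i)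
  rwa [MvPolynomial.coeff_map, MvPolynomial.coeff_zero] at this

end ParametricDivision

end NilpotentHall

open NilpotentHall in
theorem mainTheorem2 (n : ℕ) (m : MonomialOrder (NilpotentHall.Triple n)) :
    (∃ F : Fin n → NilpotentHall.MulRing n, NilpotentHall.IsMultiplicationPolynomials n F) ∧
    (∃ K : Fin n → NilpotentHall.PowRing n, NilpotentHall.IsPoweringPolynomials n K) ∧
    ∀ (F : Fin n → NilpotentHall.MulRing n) (K : Fin n → NilpotentHall.PowRing n),
      NilpotentHall.IsMultiplicationPolynomials n F →
      NilpotentHall.IsPoweringPolynomials n K →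
      ∀ B : Finset (NilpotentHall.ParamRing n),
        NilpotentHall.IsGroebnerBasis m B (NilpotentHall.consistencyIdeal F) →
        (∃! F' : Fin n → NilpotentHall.MulRing n,
          ∀ i, NilpotentHall.IsParamRemainder m B (F i) (F' i)) ∧
        (∃! K' : Fin n → NilpotentHall.PowRing n,
          ∀ i, NilpotentHall.IsParamRemainder m B (K i) (K' i)) ∧
        ∀ (F' : Fin n → NilpotentHall.MulRing n) (K' : Fin n → NilpotentHall.PowRing n),
          (∀ i, NilpotentHall.IsParamRemainder m B (F i) (F' i)) →
          (∀ i, NilpotentHall.IsParamRemainder m B (K i) (K' i)) →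
          (∀ t ∈ NilpotentHall.consistentSet n, ∀ (x y : Fin n → ℤ) (z : ℤ) (i : Fin n),
            NilpotentHall.evalMul t x y (F' i) = NilpotentHall.evalMul t x y (F i) ∧
            NilpotentHall.evalPow t x z (K' i) = NilpotentHall.evalPow t x z (K i)) ∧
          NilpotentHall.IsMultiplicationPolynomials n F' ∧
          NilpotentHall.IsPoweringPolynomials n K' := by
  refine ⟨exists_multiplicationPolynomials n, exists_poweringPolynomials n,
    fun F K hF hK B hB => ⟨existsUnique_isParamRemainder hB F, existsUnique_isParamRemainder hB K,
      fun F' K' hF' hK' => ?_⟩⟩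
  -- The ideal comes from F alone, but vanishing of B on C_n is all that reducing K requires.
  have hB0 : ∀ t ∈ consistentSet n, ∀ b ∈ B, MvPolynomial.eval (fun s => (t s : ℚ)) b = 0 :=
    fun t ht b hb => eval_eq_zero_of_mem_consistencyIdeal hF ht (hB.1 b hb).1
  have hFF' : ∀ t ∈ consistentSet n, ∀ x y i, evalMul t x y (F' i) = evalMul t x y (F i) :=
    fun t ht x y i => (hF' i).evalAt_eq (hB0 t ht) _
  have hKK' : ∀ t ∈ consistentSet n, ∀ x z i, evalPow t x z (K' i) = evalPow t x z (K i) :=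
    fun t ht x z i => (hK' i).evalAt_eq (hB0 t ht) _
  refine ⟨fun t ht x y z i => ⟨hFF' t ht x y i, hKK' t ht x z i⟩, fun t ht x y => ?_,
    fun t ht x z => ?_⟩
  · obtain ⟨e, he, h⟩ := hF t ht x y
    exact ⟨e, fun i => (hFF' t ht x y i).trans (he i), h⟩
  · obtain ⟨e, he, h⟩ := hK t ht x z
    exact ⟨e, fun i => (hKK' t ht x z i).trans (he i), h⟩
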